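/- For $k\ge 1$ let $P_k$ denote the path on $k$ vertices, $K_k$ the complete graph on $k$ vertices, and $M_k$ the matching consisting of $k$ pairwise disjoint edges. For a family $\mathcal F$ of graphs let $\mathrm{ex}(n,\mathcal F)$ be the largest number of edges of an $n$-vertex graph that contains no member of $\mathcal F$ as a (not necessarily induced) subgraph. Let $G(m,k)$ denote the $m$-vertex graph in which $k$ vertices are adjacent to all other vertices and the remaining $m-k$ vertices are pairwise non-adjacent. Let $2\le \ell\le s$ be integers. (a) If $\ell$ divides $s-\ell+1$, then for all sufficiently large $n$ (depending on $\ell$ and $s$) $$\mathrm{ex}(n,\{P_{2\ell+1},M_{s+1}\})=(\ell-1)(n-2s+\ell-1)+\binom{\ell-1}{2}+(s-\ell+1)(2\ell-1),$$ and this value is attained by the vertex-disjoint union of $G(n-2s+2\ell-2,\ell-1)$ and $(s-\ell+1)/\ell$ copies of $K_{2\ell}$. (b) If $\ell$ does not divide $s-\ell+1$, let $t=\lfloor (s-\ell+1)/\ell\rfloor$. Then for all sufficiently large $n$ (depending on $\ell$ and $s$) $$\mathrm{ex}(n,\{P_{2\ell+1},M_{s+1}\})=(\ell-1)(n-\ell+1-2\ell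 t)+1+\binom{\ell-1}{2}+t\binom{2\ell}{2},$$ and this value is attained by the vertex-disjoint union of $t$ copies of $K_{2\ell}$ and the graph obtained from $G(n-2\ell t,\ell-1)$ by adding one edge between two of its vertices of degree $\ell-1$. -/

import Mathlib

/-- A graph `G` is `𝓕`-free if no member of the family `𝓕` of finite graphs is (isomorphic to)
a not necessarily induced subgraph of `G`. -/
def FamilyFree {V : Type*} (𝓕 : Set (Σ m : ℕ, SimpleGraph (Fin m))) (G : SimpleGraph V) : Prop :=
  ∀ F ∈ 𝓕, F.2.Free G

open Classical in
/-- `ex(n, 𝓕)`: the largest number of edges of an `𝓕`-free graph on `n` vertices. -/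
noncomputable def exFamily (n : ℕ) (𝓕 : Set (Σ m : ℕ, SimpleGraph (Fin m))) : ℕ :=
  (Finset.univ.filter fun G : SimpleGraph (Fin n) => FamilyFree 𝓕 G).sup
    fun G => G.edgeFinset.card

/-- An `𝓕`-free graph on `n` vertices with `ex(n, 𝓕)` edges. -/
def IsExtremalFor {n : ℕ} (𝓕 : Set (Σ m : ℕ, SimpleGraph (Fin m)))
    (G : SimpleGraph (Fin n)) : Prop :=
  FamilyFree 𝓕 G ∧ G.edgeSet.ncard = exFamily n 𝓕

/-- The matching `M_k`: `k` independent edges `{2i, 2i+1}`, on `2k` vertices. -/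
def matchingGraph (k : ℕ) : SimpleGraph (Fin (2 * k)) where
  Adj u v := u ≠ v ∧ u.val / 2 = v.val / 2
  symm := ⟨fun _ _ h => ⟨h.1.symm, h.2.symm⟩⟩
  loopless := ⟨fun _ h => h.1 rfl⟩

/-- The family `{P_k, M_r}`, where `P_k` is the path on `k` vertices. -/
def pathMatchingFamily (k r : ℕ) : Set (Σ m : ℕ, SimpleGraph (Fin m)) :=
  {⟨k, SimpleGraph.pathGraph k⟩, ⟨2 * r, matchingGraph r⟩}

/-- The graph `G(m, k)` on `m` vertices: the first `k` vertices are adjacent to all other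
vertices, and the remaining `m - k` vertices are pairwise non-adjacent. -/
def hubGraph (m k : ℕ) : SimpleGraph (Fin m) where
  Adj u v := u ≠ v ∧ (u.val < k ∨ v.val < k)
  symm := ⟨fun _ _ h => ⟨h.1.symm, h.2.symm⟩⟩
  loopless := ⟨fun _ h => h.1 rfl⟩

/-- The graph `G(m, k)` with one further edge, joining two of the vertices of degree `k`. -/
def hubGraphPlusEdge (m k : ℕ) : SimpleGraph (Fin m) :=
  hubGraph m k ⊔ SimpleGraph.fromRel fun u v => u.val = k ∧ v.val = k + 1

/-- `t` vertex-disjoint copies of the complete graph `K_m`. -/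
def cliqueCopies (t m : ℕ) : SimpleGraph (Fin t × Fin m) where
  Adj x y := x ≠ y ∧ x.1 = y.1
  symm := ⟨fun _ _ h => ⟨h.1.symm, h.2.symm⟩⟩
  loopless := ⟨fun _ h => h.1 rfl⟩

/-! Put k = ℓ - 1, so that the forbidden path has 2k + 3 vertices. Every edge in excess of k per
vertex has to be paid for by matching edges beyond the k that a hub already provides, and only s - k
of those are available.

Upper bound. Without a matching of size s + 1, boundedly many vertices S cover all edges. Either all
but boundedly many of the other vertices have fewer than k neighbours in S, and there are at most (k
- 1)n + O(1) edges, too few for large n; or, by pigeonhole, some k-set A has many common neighbours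
W (`exists_hub_or_adjCount_le`). In the second case delete vertices outside A ∪ W of degree at most
k, each costing at most k edges. In what remains let R be the vertices outside A with a neighbour in
A, and U the rest. A path can zigzag between A and W through all of A, so two further edges in the
wrong place would make it too long (`not_adj_of_hub`, `edges_meet_of_hub`). Hence no edge joins A ∪
R to U, and R spans e ≤ 1 edges. Inside U the same deletion leaves minimum degree above k; a longest
path then closes to a cycle and spans a whole component, on at most 2k + 2 vertices. Only components
of order exactly 2k + 2 exceed k edges per vertex, by at most k + 1, and each has a perfect matching
of k + 1 edges (`exists_matching_adjCount_le`).

Thus the excess is at most e + (k + 1)q, where e ≤ 1 and k + e + (k + 1)q ≤ s. If k + 1 divides s -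
k, all of s - k can be used with e = 0; otherwise the optimum is q = ⌊(s - k)/(k + 1)⌋ and e = 1.
The stated graphs attain these values: they have no long path by pigeonhole on hub incidences
(`not_path_of_hub`) and no large matching by counting (`matchingGraph_free_sum`). -/

/-- The number of ordered pairs `(x, y)` of adjacent vertices with `x ∈ X` and `y ∈ Y`. -/
noncomputable def adjCount {V : Type*} (G : SimpleGraph V) (X Y : Finset V) : ℕ :=
  open Classical in ∑ x ∈ X, (Y.filter (G.Adj x)).card

/-- Every path of `G` has fewer than `k` vertices. -/
def PathsShorterThan {V : Type*} (G : SimpleGraph V) (k : ℕ) : Prop :=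
  ∀ p : List V, p.Nodup → p.IsChain G.Adj → p.length < k

/-- `HasMatching G X r`: there are `r` independent edges of `G` inside `X`. -/
inductive HasMatching {V : Type*} [DecidableEq V] (G : SimpleGraph V) : Finset V → ℕ → Prop
  | zero (X : Finset V) : HasMatching G X 0
  | succ (X : Finset V) (r : ℕ) (u v : V) (hu : u ∈ X) (hv : v ∈ X) (h : G.Adj u v)
      (hr : HasMatching G ((X.erase u).erase v) r) : HasMatching G X (r + 1)

/-! ### Counting edges, twice each, within and between vertex sets -/

section adjCount

variable {V : Type*} (G : SimpleGraph V)

open Classical in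
theorem adjCount_eq_sum (X Y : Finset V) :
    adjCount G X Y = ∑ x ∈ X, ∑ y ∈ Y, if G.Adj x y then 1 else 0 := by
  unfold adjCount
  refine Finset.sum_congr rfl fun x _ => ?_
  rw [Finset.card_filter]

theorem adjCount_comm (X Y : Finset V) : adjCount G X Y = adjCount G Y X := by
  classical
  rw [adjCount_eq_sum, adjCount_eq_sum, Finset.sum_comm]
  simp only [G.adj_comm]

theorem adjCount_union_left [DecidableEq V] {X Y : Finset V} (h : Disjoint X Y) (Z : Finset V) :
    adjCount G (X ∪ Y) Z = adjCount G X Z + adjCount G Y Z := by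
  simp only [adjCount]
  rw [Finset.sum_union h]

theorem adjCount_union_right [DecidableEq V] {X Y : Finset V} (h : Disjoint X Y) (Z : Finset V) :
    adjCount G Z (X ∪ Y) = adjCount G Z X + adjCount G Z Y := by
  rw [adjCount_comm, adjCount_union_left G h, adjCount_comm G X, adjCount_comm G Y]

theorem adjCount_union_self [DecidableEq V] {X Y : Finset V} (h : Disjoint X Y) :
    adjCount G (X ∪ Y) (X ∪ Y) =
      adjCount G X X + 2 * adjCount G X Y + adjCount G Y Y := by
  rw [adjCount_union_left G h, adjCount_union_right G h, adjCount_union_right G h,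
    adjCount_comm G Y X]
  ring

theorem adjCount_eq_zero {X Y : Finset V} (h : ∀ x ∈ X, ∀ y ∈ Y, ¬ G.Adj x y) :
    adjCount G X Y = 0 := by
  classical
  refine Finset.sum_eq_zero fun x hx => ?_
  rw [Finset.card_eq_zero, Finset.filter_eq_empty_iff]
  exact fun y hy => h x hx y hy

theorem adjCount_le_mul (X Y : Finset V) : adjCount G X Y ≤ X.card * Y.card := by
  classical
  refine (Finset.sum_le_card_nsmul X _ Y.card fun x _ => Finset.card_filter_le _ _).trans ?_
  simp

theorem adjCount_self_le (X : Finset V) : adjCount G X X ≤ X.card * (X.card - 1) := by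
  classical
  refine (Finset.sum_le_card_nsmul X _ (X.card - 1) fun x hx => ?_).trans (by simp)
  rw [← Finset.card_erase_of_mem hx]
  refine Finset.card_le_card fun y hy => ?_
  rw [Finset.mem_filter] at hy
  exact Finset.mem_erase.2 ⟨hy.2.ne', hy.1⟩

open Classical in
theorem adjCount_erase [DecidableEq V] {X : Finset V} {v : V} (hv : v ∈ X) :
    adjCount G X X =
      adjCount G (X.erase v) (X.erase v) + 2 * (X.filter (G.Adj v)).card := by
  have hX : X = {v} ∪ X.erase v := by
    ext y; by_cases h : y = v <;> simp [h, hv]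
  have hd : Disjoint {v} (X.erase v) := by simp
  have h1 : adjCount G {v} {v} = 0 := adjCount_eq_zero G (by simp)
  have h2 : adjCount G {v} (X.erase v) = (X.filter (G.Adj v)).card := by
    simp only [adjCount, Finset.sum_singleton]
    congr 1
    ext y
    simp only [Finset.mem_filter, Finset.mem_erase]
    exact ⟨fun h => ⟨h.1.2, h.2⟩, fun h => ⟨⟨h.2.ne', h.1⟩, h.2⟩⟩
  conv_lhs => rw [hX]
  rw [adjCount_union_self G hd, h1, h2]
  ring

theorem adjCount_univ [Fintype V] :
    adjCount G Finset.univ Finset.univ = 2 * G.edgeSet.ncard := by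
  classical
  rw [← SimpleGraph.coe_edgeFinset, Set.ncard_coe_finset,
    ← SimpleGraph.sum_degrees_eq_twice_card_edges]
  refine Finset.sum_congr rfl fun x _ => ?_
  rw [← SimpleGraph.card_neighborFinset_eq_degree, SimpleGraph.neighborFinset_eq_filter]

end adjCount

/-! ### Matchings inside a vertex set -/

section Matching

variable {V : Type*} [DecidableEq V] {G : SimpleGraph V}

theorem HasMatching.mono {X : Finset V} {r : ℕ} (h : HasMatching G X r) :
    ∀ {Y : Finset V}, X ⊆ Y → HasMatching G Y r := by
  induction h with
  | zero X => exact fun _ => HasMatching.zero _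
  | succ X r u v hu hv h _ ih =>
    exact fun hXY => HasMatching.succ _ _ u v (hXY hu) (hXY hv) h
      (ih (Finset.erase_subset_erase _ (Finset.erase_subset_erase _ hXY)))

theorem HasMatching.of_le {X : Finset V} {r : ℕ} (h : HasMatching G X r) :
    ∀ {q : ℕ}, q ≤ r → HasMatching G X q := by
  induction h with
  | zero X => intro q hq; obtain rfl : q = 0 := by omega
              exact HasMatching.zero _
  | succ X r u v hu hv h _ ih =>
    intro q hq
    cases q with
    | zero => exact HasMatching.zero _
    | succ q => exact HasMatching.succ _ _ u v hu hv h (ih (by omega))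

theorem HasMatching.union {X : Finset V} {r : ℕ} (h : HasMatching G X r) :
    ∀ {Y : Finset V} {q : ℕ}, Disjoint X Y → HasMatching G Y q →
      HasMatching G (X ∪ Y) (r + q) := by
  induction h with
  | zero X =>
    intro Y q _ hY
    rw [Nat.zero_add]
    exact hY.mono Finset.subset_union_right
  | succ X r u v hu hv h _ ih =>
    intro Y q hd hY
    rw [Nat.add_right_comm]
    refine HasMatching.succ _ _ u v (Finset.mem_union_left _ hu) (Finset.mem_union_left _ hv) h ?_
    refine (ih (hd.mono_left ((Finset.erase_subset _ _).trans (Finset.erase_subset _ _)))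
      hY).mono ?_
    intro y hy
    have := Finset.disjoint_left.1 hd
    simp only [Finset.mem_union, Finset.mem_erase] at hy ⊢
    rcases hy with hy | hy
    · exact ⟨hy.1, hy.2.1, Or.inl hy.2.2⟩
    · exact ⟨fun e => this hv (e ▸ hy), fun e => this hu (e ▸ hy), Or.inr hy⟩

theorem HasMatching.of_adj {u v : V} (h : G.Adj u v) : HasMatching G {u, v} 1 :=
  HasMatching.succ _ _ u v (by simp) (by simp) h (HasMatching.zero _)

theorem HasMatching.of_path (r : ℕ) : ∀ {p : List V}, p.Nodup → p.IsChain G.Adj →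
    p.length = 2 * r → HasMatching G p.toFinset r := by
  induction r with
  | zero => exact fun _ _ _ => HasMatching.zero _
  | succ r ih =>
    intro p hn hc hl
    match p, hl with
    | [], hl => simp at hl
    | [a], hl => simp at hl; omega
    | a :: b :: p, hl =>
      have h1 : G.Adj a b := by simp at hc; exact hc.1
      have h2 := ih (p := p) (by simp at hn; exact hn.2.2)
        (hc.tail.tail) (by simp at hl; omega)
      have h3 := (HasMatching.of_adj h1).union (Y := p.toFinset) (by
        simp at hn
        simp [hn.1.2, hn.2.1]) h2
      rw [Nat.add_comm]
      refine h3.mono ?_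
      intro y; simp

theorem HasMatching.of_complete_bipartite (A : Finset V) : ∀ (W : Finset V), Disjoint A W →
    A.card ≤ W.card → (∀ a ∈ A, ∀ w ∈ W, G.Adj a w) → HasMatching G (A ∪ W) A.card := by
  induction A using Finset.induction_on with
  | empty => exact fun _ _ _ _ => HasMatching.zero _
  | insert a A ha ih =>
    intro W hd hc hadj
    rw [Finset.card_insert_of_notMem ha] at hc ⊢
    obtain ⟨w, hw⟩ : W.Nonempty := Finset.card_pos.1 (by omega)
    rw [Finset.disjoint_insert_left] at hd
    have h1 := ih (W.erase w) (hd.2.mono_right (Finset.erase_subset _ _))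
      (by rw [Finset.card_erase_of_mem hw]; omega)
      (fun b hb x hx => hadj b (Finset.mem_insert_of_mem hb) x (Finset.mem_of_mem_erase hx))
    refine HasMatching.succ _ _ a w (by simp) (by simp [hw])
      (hadj a (Finset.mem_insert_self _ _) w hw) (h1.mono ?_)
    intro y hy
    have := Finset.disjoint_left.1 hd.2
    simp only [Finset.mem_union, Finset.mem_erase, Finset.mem_insert] at hy ⊢
    rcases hy with hy | hy
    · exact ⟨fun e => this hy (e ▸ hw), fun e => ha (e ▸ hy), Or.inl (Or.inr hy)⟩
    · exact ⟨hy.1, fun e => hd.1 (e ▸ hy.2), Or.inr hy.2⟩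

theorem HasMatching.exists_fun [Nonempty V] {X : Finset V} {r : ℕ} (h : HasMatching G X r) :
    ∃ f : ℕ → V, (∀ i < 2 * r, f i ∈ X) ∧ (∀ i < 2 * r, ∀ j < 2 * r, f i = f j → i = j) ∧
      ∀ i < r, G.Adj (f (2 * i)) (f (2 * i + 1)) := by
  induction h with
  | zero X =>
    exact ⟨fun _ => Classical.arbitrary V, by simp, by simp, by simp⟩
  | succ X r u v hu hv h _ ih =>
    obtain ⟨f, hX, hi, ha⟩ := ih
    -- The new edge goes to the last two positions, so the earlier pairs keep their indices.
    refine ⟨fun i => if i = 2 * r then u else if i = 2 * r + 1 then v else f i, ?_, ?_, ?_⟩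
    · intro i hr
      dsimp only
      have := hX i
      simp only [Finset.mem_erase] at this
      grind
    · intro i hr j hj
      dsimp only
      have h1 := hX i
      have h2 := hX j
      have h3 := hi i
      have h4 := h.ne
      simp only [Finset.mem_erase] at h1 h2
      grind
    · intro i hr
      dsimp only
      have := ha i
      grind

theorem isContained_matchingGraph {X : Finset V} {r : ℕ} (h : HasMatching G X r) :
    (matchingGraph r).IsContained G := by
  cases isEmpty_or_nonempty V with
  | inl hV =>
    cases h with
    | zero => exact ⟨⟨⟨fun i : Fin 0 => i.elim0, fun {i} => i.elim0⟩, fun i => i.elim0⟩⟩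
    | succ => exact hV.elim ‹V›
  | inr hV =>
    obtain ⟨f, -, hi, ha⟩ := h.exists_fun
    refine ⟨⟨⟨fun i => f i.val, ?_⟩, fun i j hij => Fin.ext (hi _ i.2 _ j.2 hij)⟩⟩
    intro i j hij
    have h1 : i.val ≠ j.val := fun e => hij.1 (Fin.ext e)
    have h2 : i.val / 2 = j.val / 2 := hij.2
    have h3 := ha (i.val / 2) (by omega)
    rcases Nat.lt_or_gt_of_ne h1 with hlt | hlt
    · have e1 : 2 * (i.val / 2) = i.val := by omega
      have e2 : i.val + 1 = j.val := by omega
      rwa [e1, e2] at h3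
    · have e1 : 2 * (i.val / 2) = j.val := by omega
      have e2 : j.val + 1 = i.val := by omega
      rw [e1, e2] at h3
      exact h3.symm

/-- The ends of a greedily chosen maximal matching cover all edges. -/
theorem exists_cover_of_not_hasMatching (r : ℕ) : ∀ X : Finset V, ¬ HasMatching G X r →
    ∃ S ⊆ X, S.card ≤ 2 * r ∧ ∀ u ∈ X \ S, ∀ v ∈ X \ S, ¬ G.Adj u v := by
  induction r with
  | zero => exact fun X h => absurd (HasMatching.zero X) h
  | succ r ih =>
    intro X h
    by_cases he : ∃ u ∈ X, ∃ v ∈ X, G.Adj u v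
    · obtain ⟨u, hu, v, hv, huv⟩ := he
      obtain ⟨S, hS, hc, hi⟩ := ih ((X.erase u).erase v)
        (fun hm => h (HasMatching.succ _ _ u v hu hv huv hm))
      refine ⟨insert u (insert v S), ?_, ?_, ?_⟩
      · intro y hy
        simp only [Finset.mem_insert] at hy
        rcases hy with rfl | rfl | hy
        · exact hu
        · exact hv
        · exact Finset.mem_of_mem_erase (Finset.mem_of_mem_erase (hS hy))
      · have := Finset.card_insert_le u (insert v S)
        have := Finset.card_insert_le v S
        omega
      · intro x hx y hy
        simp only [Finset.mem_sdiff, Finset.mem_insert, Finset.mem_erase] at hx hy hi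
        grind
    · push Not at he
      exact ⟨∅, by simp, by simp, fun u hu v hv => he u (by simpa using hu) v (by simpa using hv)⟩

end Matching

/-! ### Longest paths and dense components -/

theorem pathsShorterThan_of_free {V : Type*} {G : SimpleGraph V} {k : ℕ}
    (h : (SimpleGraph.pathGraph k).Free G) : PathsShorterThan G k := by
  intro p hn hc
  by_contra! hk
  refine h ⟨⟨⟨fun i => p[i.val]'(by omega), ?_⟩, ?_⟩⟩
  · intro i j hij
    rw [SimpleGraph.pathGraph_adj] at hij
    rw [List.isChain_iff_getElem] at hc
    rcases hij with hij | hij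
    · have := hc i.val (by omega)
      simpa [hij] using this
    · have := (hc j.val (by omega)).symm
      simpa [hij] using this
  · intro i j hij
    have := (List.Nodup.getElem_inj_iff hn).1 hij
    exact Fin.ext this

theorem PathsShorterThan.exists_longest {V : Type*} {G : SimpleGraph V} {m : ℕ}
    (h : PathsShorterThan G m) {X : Finset V} :
    ∃ p : List V, (p.Nodup ∧ p.IsChain G.Adj ∧ ∀ v ∈ p, v ∈ X) ∧
      ∀ q : List V, q.Nodup → q.IsChain G.Adj → (∀ v ∈ q, v ∈ X) → q.length ≤ p.length := by
  classical
  let P : ℕ → Prop := fun l => ∃ p : List V, (p.Nodup ∧ p.IsChain G.Adj ∧ ∀ v ∈ p, v ∈ X) ∧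
    p.length = l
  have h0 : P 0 := ⟨[], by simp, rfl⟩
  obtain ⟨p, hp, hl⟩ := Nat.findGreatest_spec (P := P) (Nat.zero_le m) h0
  refine ⟨p, hp, fun q h1 h2 h3 => ?_⟩
  rw [hl]
  exact Nat.le_findGreatest (h q h1 h2).le ⟨q, ⟨h1, h2, h3⟩, rfl⟩

/-- A longest path whose ends both have more than `k` neighbours, on at most `2 * k + 2` vertices,
splits in two so that swapping the first half gives a Hamiltonian cycle on its vertices. -/
theorem exists_crossing {V : Type*} {G : SimpleGraph V} {k : ℕ} {X : Finset V} {p : List V}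
    (hn : p.Nodup) (hc : p.IsChain G.Adj) (hX : ∀ v ∈ p, v ∈ X)
    (hmax : ∀ q : List V, q.Nodup → q.IsChain G.Adj → (∀ v ∈ q, v ∈ X) → q.length ≤ p.length)
    (hdeg : ∀ v ∈ X, ∃ N : Finset V, k < N.card ∧ ∀ y ∈ N, y ∈ X ∧ G.Adj v y)
    (hlen : p.length ≤ 2 * k + 2) (hpos : 0 < p.length) :
    ∃ i, ∃ hi : i + 1 < p.length, G.Adj p[0] p[i + 1] ∧
      G.Adj (p[p.length - 1]) (p[i]) := by
  classical
  obtain ⟨N, hNc, hN⟩ := hdeg p[0] (hX _ (List.getElem_mem _))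
  obtain ⟨M, hMc, hM⟩ := hdeg p[p.length - 1] (hX _ (List.getElem_mem _))
  -- A neighbour of an end off the path would extend it, so by maximality `N` and `M` lie on the
  -- path.
  have hNp : ∀ y ∈ N, y ∈ p := by
    intro y hy
    by_contra hyp
    have := hmax (y :: p) (List.nodup_cons.2 ⟨hyp, hn⟩)
      (by
        cases p with
        | nil => simp at hpos
        | cons a p => exact List.isChain_cons_cons.2 ⟨(hN y hy).2.symm, hc⟩)
      (by
        intro v hv
        rcases List.mem_cons.1 hv with rfl | hv
        · exact (hN _ hy).1
        · exact hX v hv)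
    simp at this
  have hMp : ∀ y ∈ M, y ∈ p := by
    intro y hy
    by_contra hyp
    have := hmax (p ++ [y])
      (by
        rw [List.nodup_append]
        refine ⟨hn, by simp, ?_⟩
        intro a ha b hb e
        simp at hb
        exact hyp (hb ▸ e ▸ ha))
      (by
        refine hc.append (List.isChain_singleton _) ?_
        intro x hx z hz
        have e := (hM y hy).2
        rw [List.getLast?_eq_getElem?, List.getElem?_eq_getElem (by omega)] at hx
        simp at hx hz
        rw [← hx, ← hz]
        exact e)
      (by
        intro v hv
        rcases List.mem_append.1 hv with hv | hv
        · exact hX v hv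
        · simp at hv
          exact hv ▸ (hM _ hy).1)
    simp at this
  -- Total indexing of the path; the default value is never used.
  let f : ℕ → V := fun i => p.getD i p[0]
  have hf : ∀ i (hi : i < p.length), f i = p[i] := fun i hi => by
    simp [f, List.getD, List.getElem?_eq_getElem hi]
  -- `I` and `J` each have more than `k` elements among at most `2 * k + 1` indices, so they meet.
  let I := (Finset.range (p.length - 1)).filter fun i => G.Adj p[0] (f (i + 1))
  let J := (Finset.range (p.length - 1)).filter fun i => G.Adj p[p.length - 1] (f i)
  have hI : k < I.card := by
    refine lt_of_lt_of_le hNc ((Finset.card_le_card ?_).trans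
      (Finset.card_image_le (s := I) (f := fun i => f (i + 1))))
    intro y hy
    obtain ⟨j, hj, rfl⟩ := List.getElem_of_mem (hNp y hy)
    have hadj := (hN _ hy).2
    have hj0 : j ≠ 0 := by rintro rfl; exact hadj.ne rfl
    refine Finset.mem_image.2 ⟨j - 1, ?_, ?_⟩
    · rw [Finset.mem_filter, Finset.mem_range, Nat.sub_add_cancel (by omega), hf j hj]
      exact ⟨by omega, hadj⟩
    · simp only [Nat.sub_add_cancel (Nat.pos_of_ne_zero hj0), hf j hj]
  have hJ : k < J.card := by
    refine lt_of_lt_of_le hMc ((Finset.card_le_card ?_).trans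
      (Finset.card_image_le (s := J) (f := f)))
    intro y hy
    obtain ⟨j, hj, rfl⟩ := List.getElem_of_mem (hMp y hy)
    have hadj := (hM _ hy).2
    have hj0 : j ≠ p.length - 1 := by rintro rfl; exact hadj.ne rfl
    refine Finset.mem_image.2 ⟨j, ?_, hf j hj⟩
    rw [Finset.mem_filter, Finset.mem_range, hf j hj]
    exact ⟨by omega, hadj⟩
  have hIJ : ¬ Disjoint I J := by
    intro hd
    have h1 := Finset.card_union_of_disjoint hd
    have h2 : (I ∪ J).card ≤ (Finset.range (p.length - 1)).card :=
      Finset.card_le_card (Finset.union_subset (Finset.filter_subset _ _)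
        (Finset.filter_subset _ _))
    rw [Finset.card_range] at h2
    omega
  obtain ⟨i, hi1, hi2⟩ := Finset.not_disjoint_iff.1 hIJ
  simp only [I, J, Finset.mem_filter, Finset.mem_range] at hi1 hi2
  rw [hf _ (by omega)] at hi1 hi2
  exact ⟨i, by omega, hi1.2, hi2.2⟩

/-- If the two ends of a path are adjacent, each of its vertices starts a path on the same
vertices. -/
theorem exists_rotation {V : Type*} {G : SimpleGraph V} {c : List V}
    (hn : c.Nodup) (hc : c.IsChain G.Adj)
    (hcyc : ∀ x ∈ c.getLast?, ∀ y ∈ c.head?, G.Adj x y) {v : V} (hv : v ∈ c) :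
    ∃ q : List V, (v :: q).Nodup ∧ (v :: q).IsChain G.Adj ∧ (v :: q).Perm c := by
  obtain ⟨a, b, rfl⟩ := List.append_of_mem hv
  have hperm : (v :: (b ++ a)).Perm (a ++ v :: b) := by
    rw [← List.cons_append]
    exact List.perm_append_comm
  refine ⟨b ++ a, hperm.nodup_iff.2 hn, ?_, hperm⟩
  rw [List.isChain_append] at hc
  rw [← List.cons_append]
  refine hc.2.1.append hc.1 ?_
  intro x hx y hy
  refine hcyc x ?_ y ?_
  · rw [List.getLast?_append, hx]; rfl
  · rw [List.head?_append, hy]; rfl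

/-- The vertex set of a longest path as in `exists_crossing` is a union of components. -/
theorem longest_path_closed {V : Type*} {G : SimpleGraph V} {k : ℕ} {X : Finset V} {p : List V}
    (hn : p.Nodup) (hc : p.IsChain G.Adj) (hX : ∀ v ∈ p, v ∈ X)
    (hmax : ∀ q : List V, q.Nodup → q.IsChain G.Adj → (∀ v ∈ q, v ∈ X) → q.length ≤ p.length)
    (hdeg : ∀ v ∈ X, ∃ N : Finset V, k < N.card ∧ ∀ y ∈ N, y ∈ X ∧ G.Adj v y)
    (hlen : p.length ≤ 2 * k + 2) {v x : V} (hv : v ∈ p) (hx : x ∈ X) (hvx : G.Adj v x) :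
    x ∈ p := by
  have hpos : 0 < p.length := List.length_pos_of_mem hv
  obtain ⟨i, hi, h1, h2⟩ := exists_crossing hn hc hX hmax hdeg hlen hpos
  by_contra hxp
  have hsplit : p = p.take (i + 1) ++ p.drop (i + 1) := (List.take_append_drop _ _).symm
  -- The reordered path is p[i], …, p[0], p[i+1], …, p[last]. One crossing edge joins the two pieces
  -- and the other joins its ends, making a cycle.
  have hperm : ((p.take (i + 1)).reverse ++ p.drop (i + 1)).Perm p := by
    conv_rhs => rw [hsplit]
    exact (List.reverse_perm _).append_right _
  have hn' := hperm.nodup_iff.2 hn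
  have hrot : ((p.take (i + 1)).reverse ++ p.drop (i + 1)).IsChain G.Adj := by
    refine List.IsChain.append ?_ (hc.drop _) ?_
    · rw [List.isChain_reverse]
      exact (hc.take _).imp fun a b h => SimpleGraph.Adj.symm h
    · intro a ha b hb
      rw [List.getLast?_reverse, List.head?_take, if_neg (by omega),
        List.head?_eq_getElem?, List.getElem?_eq_getElem hpos] at ha
      rw [List.head?_drop, List.getElem?_eq_getElem hi] at hb
      simp at ha hb
      rw [← ha, ← hb]
      exact h1
  obtain ⟨q, hq1, hq2, hq3⟩ := exists_rotation (v := v) hn' hrot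
    (by
      intro a ha b hb
      have e1 : ((p.take (i + 1)).reverse ++ p.drop (i + 1)).getLast? = some p[p.length - 1] := by
        rw [List.getLast?_append, List.getLast?_drop, if_neg (by omega),
          List.getLast?_eq_getElem?, List.getElem?_eq_getElem (by omega)]
        rfl
      have e2 : ((p.take (i + 1)).reverse ++ p.drop (i + 1)).head? = some p[i] := by
        rw [List.head?_append, List.head?_reverse, List.getLast?_take, if_neg (by omega)]
        simp [List.getElem?_eq_getElem (show i < p.length by omega)]
      rw [e1] at ha
      rw [e2] at hb
      simp at ha hb
      rw [← ha, ← hb]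
      exact h2)
    (hperm.mem_iff.2 hv)
  have hq4 := hq3.trans hperm
  -- Opening the cycle at `v` and prefixing the outside neighbour `x` would beat the longest path.
  have := hmax (x :: v :: q)
    (List.nodup_cons.2 ⟨fun h => hxp (hq4.mem_iff.1 h), hq1⟩)
    (List.isChain_cons_cons.2 ⟨hvx.symm, hq2⟩)
    (by
      intro y hy
      rcases List.mem_cons.1 hy with rfl | hy
      · exact hx
      · exact hX y (hq4.mem_iff.1 hy))
  have := hq4.length_eq
  simp at *
  omega

/-- In a graph without a path on `2 * k + 3` vertices, the edges inside a set `X` in excess of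
`k * |X|` are paid for by a matching inside `X`. -/
theorem exists_matching_adjCount_le {V : Type*} [DecidableEq V] {G : SimpleGraph V} {k : ℕ}
    (hG : PathsShorterThan G (2 * k + 3)) (X : Finset V) :
    ∃ q, HasMatching G X ((k + 1) * q) ∧
      adjCount G X X ≤ 2 * k * X.card + 2 * ((k + 1) * q) := by
  classical
  induction X using Finset.strongInduction with
  | H X ih =>
  by_cases hX : X = ∅
  · subst hX
    exact ⟨0, HasMatching.zero _, by simp [adjCount]⟩
  -- Deleting a vertex of degree at most `k` lowers `adjCount` by at most `2 * k`, just as it lowers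
  -- the bound.
  by_cases hlow : ∃ v ∈ X, (X.filter (G.Adj v)).card ≤ k
  · obtain ⟨v, hv, hdeg⟩ := hlow
    obtain ⟨q, hm, hq⟩ := ih (X.erase v) (Finset.erase_ssubset hv)
    refine ⟨q, hm.mono (Finset.erase_subset _ _), ?_⟩
    rw [adjCount_erase G hv]
    rw [← Finset.card_erase_add_one hv]
    linarith
  · push Not at hlow
    have hdeg : ∀ v ∈ X, ∃ N : Finset V, k < N.card ∧ ∀ y ∈ N, y ∈ X ∧ G.Adj v y :=
      fun v hv => ⟨_, hlow v hv, fun y hy => Finset.mem_filter.1 hy⟩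
    obtain ⟨p, ⟨hn, hc, hpX⟩, hmax⟩ := hG.exists_longest (X := X)
    have hlen : p.length ≤ 2 * k + 2 := by have := hG p hn hc; omega
    have hpos : 0 < p.length := by
      obtain ⟨x, hx⟩ := Finset.nonempty_iff_ne_empty.2 hX
      exact hmax [x] (by simp) (by simp) (by simpa using hx)
    have hcl := @longest_path_closed V G k X p hn hc hpX hmax hdeg hlen
    have hsub : p.toFinset ⊆ X := fun v hv => hpX v (List.mem_toFinset.1 hv)
    have hcard : p.toFinset.card = p.length := List.toFinset_card_of_nodup hn
    have hsplit : X = p.toFinset ∪ X \ p.toFinset := (Finset.union_sdiff_of_subset hsub).symm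
    have hdisj : Disjoint p.toFinset (X \ p.toFinset) := Finset.disjoint_sdiff
    obtain ⟨q, hm, hq⟩ := ih (X \ p.toFinset) (by
      refine Finset.sdiff_ssubset hsub (Finset.card_pos.1 (by omega)))
    have hcross : adjCount G p.toFinset (X \ p.toFinset) = 0 := by
      refine adjCount_eq_zero G fun v hv x hx hvx => ?_
      rw [Finset.mem_sdiff, List.mem_toFinset] at hx
      exact hx.2 (hcl (List.mem_toFinset.1 hv) hx.1 hvx)
    have hE : adjCount G X X = adjCount G p.toFinset p.toFinset +
        adjCount G (X \ p.toFinset) (X \ p.toFinset) := by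
      conv_lhs => rw [hsplit]
      rw [adjCount_union_self G hdisj, hcross]
      ring
    have hXc : X.card = p.length + (X \ p.toFinset).card := by
      conv_lhs => rw [hsplit]
      rw [Finset.card_union_of_disjoint hdisj, hcard]
    have hself := adjCount_self_le G p.toFinset
    rw [hcard] at hself
    -- A component on at most `2 * k + 1` vertices has degrees at most `2 * k`, hence no excess. On
    -- `2 * k + 2` vertices the excess is at most `k + 1` edges, and alternate edges of the path
    -- form a matching of that size.
    rcases Nat.lt_or_ge p.length (2 * k + 2) with hlt | hge
    · refine ⟨q, hm.mono Finset.sdiff_subset, ?_⟩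
      have : p.length * (p.length - 1) ≤ p.length * (2 * k) :=
        Nat.mul_le_mul_left _ (by omega)
      rw [hE, hXc]
      linarith
    · have hl : p.length = 2 * (k + 1) := by omega
      refine ⟨q + 1, ?_, ?_⟩
      · have := (HasMatching.of_path (k + 1) hn hc hl).union hdisj hm
        rw [← hsplit] at this
        convert this using 1
        ring
      · rw [hl, show 2 * (k + 1) - 1 = 2 * k + 1 by omega] at hself
        rw [hE, hXc, hl]
        linarith

/-! ### Zigzag paths through a hub -/

/-- A path starting in `a` can be prolonged by zigzagging between a set `A` and a set `W` of
common neighbours of `a` and `A`, so that it traverses `A`. -/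
theorem exists_zigzag {V : Type*} [DecidableEq V] {G : SimpleGraph V} (A : Finset V) :
    ∀ (W : Finset V) (a : V) (p : List V), A.card < W.card →
      (a :: p).Nodup → (a :: p).IsChain G.Adj →
      (∀ w ∈ W, G.Adj w a ∧ w ∉ a :: p ∧ w ∉ A) → (∀ b ∈ A, b ∉ a :: p) →
      (∀ b ∈ A, ∀ w ∈ W, G.Adj b w) →
      ∃ (b : V) (q : List V), (b :: q).Nodup ∧ (b :: q).IsChain G.Adj ∧
        (b :: q).length = (a :: p).length + 2 * A.card ∧ (b = a ∨ b ∈ A) ∧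
        (∀ v ∈ b :: q, v ∈ a :: p ∨ v ∈ A ∨ v ∈ W) ∧ ∃ w ∈ W, w ∉ b :: q := by
  induction A using Finset.induction_on with
  | empty =>
    intro W a p hW hn hc hwa _ _
    obtain ⟨w, hw⟩ : W.Nonempty := Finset.card_pos.1 (by simpa using hW)
    exact ⟨a, p, hn, hc, by simp, Or.inl rfl, fun v hv => Or.inl hv, w, hw, (hwa w hw).2.1⟩
  | insert b A hb ih =>
    intro W a p hW hn hc hwa hA hadj
    rw [Finset.card_insert_of_notMem hb] at hW
    obtain ⟨w, hw⟩ : W.Nonempty := Finset.card_pos.1 (by omega)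
    have hbw := hadj b (Finset.mem_insert_self _ _) w hw
    have hbp := hA b (Finset.mem_insert_self _ _)
    obtain ⟨c, q, h1, h2, h3, h4, h5, x, hx, hxq⟩ := ih (W.erase w) b (w :: a :: p)
      (by rw [Finset.card_erase_of_mem hw]; omega)
      (by
        rw [List.nodup_cons, List.nodup_cons]
        refine ⟨fun h => ?_, (hwa w hw).2.1, hn⟩
        rcases List.mem_cons.1 h with h | h
        · exact hbw.ne h
        · exact hbp h)
      (by
        rw [List.isChain_cons_cons, List.isChain_cons_cons]
        exact ⟨hbw, (hwa w hw).1, hc⟩)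
      (by
        intro y hy
        rw [Finset.mem_erase] at hy
        have hyb := (hadj b (Finset.mem_insert_self _ _) y hy.2).symm
        refine ⟨hyb, fun h => ?_, fun h => (hwa y hy.2).2.2 (Finset.mem_insert_of_mem h)⟩
        rcases List.mem_cons.1 h with h | h
        · exact hyb.ne h
        rcases List.mem_cons.1 h with h | h
        · exact hy.1 h
        · exact (hwa y hy.2).2.1 h)
      (by
        intro y hy h
        rcases List.mem_cons.1 h with h | h
        · exact hb (h ▸ hy)
        rcases List.mem_cons.1 h with h | h
        · exact (hwa w hw).2.2 (h ▸ Finset.mem_insert_of_mem hy)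
        · exact hA y (Finset.mem_insert_of_mem hy) h)
      (fun y hy z hz => hadj y (Finset.mem_insert_of_mem hy) z (Finset.mem_of_mem_erase hz))
    refine ⟨c, q, h1, h2, ?_, ?_, ?_, x, Finset.mem_of_mem_erase hx, hxq⟩
    · rw [h3, Finset.card_insert_of_notMem hb]
      simp only [List.length_cons]
      ring
    · right
      rcases h4 with rfl | h
      · exact Finset.mem_insert_self _ _
      · exact Finset.mem_insert_of_mem h
    · intro v hv
      rcases h5 v hv with h | h | h
      · rcases List.mem_cons.1 h with rfl | h
        · exact Or.inr (Or.inl (Finset.mem_insert_self _ _))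
        rcases List.mem_cons.1 h with rfl | h
        · exact Or.inr (Or.inr hw)
        · exact Or.inl h
      · exact Or.inr (Or.inl (Finset.mem_insert_of_mem h))
      · exact Or.inr (Or.inr (Finset.mem_of_mem_erase h))

section Hub

variable {V : Type*} [DecidableEq V] {G : SimpleGraph V} {k : ℕ} {A W : Finset V}

/-- In a graph without a path on `2 * |A| + 3` vertices, no path on three vertices that avoids a
hub `A` starts at a neighbour of `A`. -/
theorem not_adj_of_hub (hG : PathsShorterThan G (2 * A.card + 3))
    (hW : A.card + 5 ≤ W.card) (hAW : ∀ a ∈ A, ∀ w ∈ W, G.Adj a w)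
    {a x y z : V} (ha : a ∈ A) (hx : x ∉ A) (hy : y ∉ A) (hz : z ∉ A) (hax : G.Adj a x)
    (hxy : G.Adj x y) (hxz : x ≠ z) : ¬ G.Adj y z := by
  intro hyz
  have hdisj : ∀ w ∈ W, w ∉ A := fun w hw hwA => (hAW w hwA w hw).ne rfl
  have hcA := Finset.card_erase_add_one ha
  have hcW : W.card ≤ (W \ {x, y, z}).card + 3 := by
    have h1 := Finset.le_card_sdiff {x, y, z} W
    have h2 : ({x, y, z} : Finset V).card ≤ 3 := Finset.card_le_three
    omega
  have hmem : ∀ w ∈ W \ {x, y, z}, w ∈ W ∧ w ≠ x ∧ w ≠ y ∧ w ≠ z := by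
    intro w hw
    simpa using hw
  -- Start from a, x, y, z, absorb the other hub vertices two steps at a time, and finish in a spare
  -- `w`: 4 + 2(|A| - 1) + 1 = 2|A| + 3 vertices.
  obtain ⟨b, q, h1, h2, h3, h4, h5, w, hw, hwq⟩ := exists_zigzag (G := G) (A.erase a)
    (W \ {x, y, z}) a [x, y, z] (by omega)
    (by
      have := hax.ne; have := hxy.ne; have := hyz.ne
      have : a ≠ y := fun e => hy (e ▸ ha)
      have : a ≠ z := fun e => hz (e ▸ ha)
      simp [*])
    (by simp [*])
    (by
      intro w hw
      obtain ⟨hw, hwx, hwy, hwz⟩ := hmem w hw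
      have hwa := (hAW a ha w hw).symm
      have := hwa.ne
      exact ⟨hwa, by simp [*], fun h => hdisj w hw (Finset.mem_of_mem_erase h)⟩)
    (by
      intro c hc
      rw [Finset.mem_erase] at hc
      have : c ≠ x := fun e => hx (e ▸ hc.2)
      have : c ≠ y := fun e => hy (e ▸ hc.2)
      have : c ≠ z := fun e => hz (e ▸ hc.2)
      simp [*])
    (fun c hc w hw => hAW c (Finset.mem_of_mem_erase hc) w (hmem w hw).1)
  have hbA : b ∈ A := by
    rcases h4 with rfl | h
    · exact ha
    · exact Finset.mem_of_mem_erase h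
  have := hG (w :: b :: q) (List.nodup_cons.2 ⟨hwq, h1⟩)
    (List.isChain_cons_cons.2 ⟨(hAW b hbA w (hmem w hw).1).symm, h2⟩)
  simp only [List.length_cons, List.length_nil] at h3 this
  omega

/-- In a graph without a path on `2 * |A| + 3` vertices, two edges outside a hub `A` with an end
adjacent to all of `A` each meet. -/
theorem edges_meet_of_hub (hG : PathsShorterThan G (2 * A.card + 3))
    (hW : A.card + 5 ≤ W.card) (hAW : ∀ a ∈ A, ∀ w ∈ W, G.Adj a w)
    {x y x' y' : V} (hA : A.Nonempty) (hx : x ∉ A) (hy : y ∉ A) (hx' : x' ∉ A) (hy' : y' ∉ A)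
    (hAx : ∀ a ∈ A, G.Adj a x) (hAx' : ∀ a ∈ A, G.Adj a x')
    (hxy : G.Adj x y) (hxy' : G.Adj x' y') : x = x' ∨ x = y' ∨ y = x' ∨ y = y' := by
  by_contra! hne
  obtain ⟨hne1, hne2, hne3, hne4⟩ := hne
  obtain ⟨a, ha⟩ := hA
  have hdisj : ∀ w ∈ W, w ∉ A := fun w hw hwA => (hAW w hwA w hw).ne rfl
  have hcA := Finset.card_erase_add_one ha
  have hcW : W.card ≤ (W \ {x, y, x', y'}).card + 4 := by
    have h1 := Finset.le_card_sdiff {x, y, x', y'} W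
    have h2 : ({x, y, x', y'} : Finset V).card ≤ 4 := Finset.card_le_four
    omega
  have hmem : ∀ w ∈ W \ {x, y, x', y'}, w ∈ W ∧ w ≠ x ∧ w ≠ y ∧ w ≠ x' ∧ w ≠ y' := by
    intro w hw
    simpa using hw
  -- The path a, x, y grows to 2|A| + 1 vertices and ends in a hub vertex `b`, from which x' and y'
  -- complete it to 2|A| + 3. Removing all four vertices from `W` keeps the zigzag clear of x' and
  -- y'.
  obtain ⟨b, q, h1, h2, h3, h4, h5, -⟩ := exists_zigzag (G := G) (A.erase a)
    (W \ {x, y, x', y'}) a [x, y] (by omega)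
    (by
      have := (hAx a ha).ne; have := hxy.ne
      have : a ≠ y := fun e => hy (e ▸ ha)
      simp [*])
    (by simp [hAx a ha, hxy])
    (by
      intro w hw
      obtain ⟨hw, hwx, hwy, -⟩ := hmem w hw
      have hwa := (hAW a ha w hw).symm
      have := hwa.ne
      exact ⟨hwa, by simp [*], fun h => hdisj w hw (Finset.mem_of_mem_erase h)⟩)
    (by
      intro c hc
      rw [Finset.mem_erase] at hc
      have : c ≠ x := fun e => hx (e ▸ hc.2)
      have : c ≠ y := fun e => hy (e ▸ hc.2)
      simp [*])
    (fun c hc w hw => hAW c (Finset.mem_of_mem_erase hc) w (hmem w hw).1)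
  have hbA : b ∈ A := by
    rcases h4 with rfl | h
    · exact ha
    · exact Finset.mem_of_mem_erase h
  have hout : ∀ v, v ∉ A → v ≠ x → v ≠ y → v ∉ W \ {x, y, x', y'} → v ∉ b :: q := by
    intro v hv1 hv2 hv3 hv4 hv
    rcases h5 v hv with h | h | h
    · have : v ≠ a := fun e => hv1 (e ▸ ha)
      simp [*] at h
    · exact hv1 (Finset.mem_of_mem_erase h)
    · exact hv4 h
  have := hG (y' :: x' :: b :: q)
    (by
      rw [List.nodup_cons, List.nodup_cons]
      refine ⟨fun h => ?_, hout x' hx' hne1.symm hne3.symm (by simp), h1⟩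
      rcases List.mem_cons.1 h with h | h
      · exact hxy'.ne h.symm
      · exact hout y' hy' hne2.symm hne4.symm (by simp) h)
    (by
      rw [List.isChain_cons_cons, List.isChain_cons_cons]
      exact ⟨hxy'.symm, (hAx' b hbA).symm, h2⟩)
  simp only [List.length_cons, List.length_nil] at h3 this
  omega

open Classical in
/-- The bound for a set `X` in which every vertex outside `A ∪ W` has more than `|A|`
neighbours. -/
theorem adjCount_le_of_hub_of_lt_degree (hG : PathsShorterThan G (2 * A.card + 3))
    (hW : A.card + 5 ≤ W.card) (hAW : ∀ a ∈ A, ∀ w ∈ W, G.Adj a w) (hA : A.Nonempty)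
    {X : Finset V} (hAX : A ⊆ X) (hWX : W ⊆ X)
    (hdeg : ∀ v ∈ X, v ∉ A → v ∉ W → A.card < (X.filter (G.Adj v)).card) :
    ∃ e q, e ≤ 1 ∧ HasMatching G X (A.card + e + (A.card + 1) * q) ∧
      adjCount G X X + 2 * A.card * A.card ≤
        A.card * (A.card - 1) + 2 * A.card * X.card + 2 * e + 2 * ((A.card + 1) * q) := by
  set R := X.filter fun v => v ∉ A ∧ ∃ a ∈ A, G.Adj a v with hR
  set U := X \ (A ∪ R) with hU
  have hdisj : ∀ w ∈ W, w ∉ A := fun w hw hwA => (hAW w hwA w hw).ne rfl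
  have hpos := hA.card_pos
  have hmR : ∀ v, v ∈ R ↔ v ∈ X ∧ v ∉ A ∧ ∃ a ∈ A, G.Adj a v := fun v => by
    rw [hR, Finset.mem_filter]
  have hWR : W ⊆ R := fun w hw => (hmR w).2
    ⟨hWX hw, hdisj w hw, hA.choose, hA.choose_spec, hAW _ hA.choose_spec w hw⟩
  have hAR : Disjoint A R := Finset.disjoint_left.2 fun v hv h => ((hmR v).1 h).2.1 hv
  have hARU : Disjoint (A ∪ R) U := Finset.disjoint_sdiff
  have hARX : A ∪ R ⊆ X := Finset.union_subset hAX (Finset.filter_subset _ _)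
  have hX : X = A ∪ R ∪ U := (Finset.union_sdiff_of_subset hARX).symm
  have hmU : ∀ v, v ∈ U ↔ v ∈ X ∧ v ∉ A ∧ v ∉ R := fun v => by
    rw [hU, Finset.mem_sdiff, Finset.mem_union, not_or]
  have hUR : ∀ x ∈ R, ∀ y ∈ U, ¬ G.Adj x y := by
    intro x hx y hy hxy
    have hyU := (hmU y).1 hy
    obtain ⟨hxX, hxA, a, ha, hax⟩ := (hmR x).1 hx
    have h1 := hdeg y hyU.1 hyU.2.1 (fun h => hyU.2.2 (hWR h))
    -- The degree of `y` exceeds |A| ≥ 1, so `y` has a neighbour other than `x`; as `y` is not in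
    -- `R`, that neighbour avoids `A`, and a forbidden x, y, z arises.
    obtain ⟨z, hz, hzx⟩ := Finset.exists_mem_ne (s := X.filter (G.Adj y)) (by omega) x
    rw [Finset.mem_filter] at hz
    have hzA : z ∉ A := fun h => hyU.2.2 ((hmR y).2 ⟨hyU.1, hyU.2.1, z, h, hz.2.symm⟩)
    exact not_adj_of_hub hG hW hAW ha hxA hyU.2.1 hzA hax hxy hzx.symm hz.2
  have hcross : adjCount G (A ∪ R) U = 0 := by
    refine adjCount_eq_zero G fun x hx y hy hxy => ?_
    rcases Finset.mem_union.1 hx with hx | hx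
    · have hyU := (hmU y).1 hy
      exact hyU.2.2 ((hmR y).2 ⟨hyU.1, hyU.2.1, x, hx, hxy⟩)
    · exact hUR x hx y hy hxy
  -- each vertex of `R` has at most one neighbour in `R`
  have huniq : ∀ x ∈ R, ∀ y ∈ R, ∀ z ∈ R, G.Adj x y → G.Adj x z → y = z := by
    intro x hx y hy z hz hxy hxz
    by_contra hne
    obtain ⟨-, hyA, a, ha, hay⟩ := (hmR y).1 hy
    exact not_adj_of_hub hG hW hAW ha hyA ((hmR x).1 hx).2.1 ((hmR z).1 hz).2.1 hay hxy.symm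
      hne hxz
  have hdegR : ∀ x ∈ R, (R.filter (G.Adj x)).card ≤ 1 := by
    intro x hx
    rw [Finset.card_le_one]
    intro y hy z hz
    rw [Finset.mem_filter] at hy hz
    exact huniq x hx y hy.1 z hz.1 hy.2 hz.2
  -- Outside `W`, a vertex of `R` has degree above |A| but at most one neighbour beyond `A`, so it
  -- sees all of `A`.
  have hfull : ∀ x ∈ R, ∀ a ∈ A, G.Adj a x := by
    intro x hx
    by_cases hxW : x ∈ W
    · exact fun a ha => hAW a ha x hxW
    have hxX := (hmR x).1 hx
    have h1 := hdeg x hxX.1 hxX.2.1 hxW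
    have h2 : X.filter (G.Adj x) ⊆ A.filter (G.Adj x) ∪ R.filter (G.Adj x) := by
      intro y hy
      rw [Finset.mem_filter] at hy
      simp only [Finset.mem_union, Finset.mem_filter]
      by_contra! h
      exact hUR x hx y ((hmU y).2 ⟨hy.1, fun h' => h.1 h' hy.2, fun h' => h.2 h' hy.2⟩) hy.2
    have h3 := (Finset.card_le_card h2).trans (Finset.card_union_le _ _)
    have h4 := hdegR x hx
    have h5 : A.filter (G.Adj x) = A :=
      Finset.eq_of_subset_of_card_le (Finset.filter_subset _ _) (by omega)
    intro a ha
    rw [← h5, Finset.mem_filter] at ha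
    exact ha.2.symm
  have hRR : ∃ e, e ≤ 1 ∧ HasMatching G (A ∪ R) (A.card + e) ∧ adjCount G R R ≤ 2 * e := by
    by_cases he : ∃ x ∈ R, ∃ y ∈ R, G.Adj x y
    · obtain ⟨x, hx, y, hy, hxy⟩ := he
      refine ⟨1, le_rfl, ?_, ?_⟩
      · have h1 : HasMatching G (A ∪ W \ {x, y}) A.card := by
          refine HasMatching.of_complete_bipartite A _ ?_ ?_ ?_
          · exact (hAR.mono_right hWR).mono_right Finset.sdiff_subset
          · have h1 := Finset.le_card_sdiff {x, y} W
            have h2 : ({x, y} : Finset V).card ≤ 2 := Finset.card_le_two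
            omega
          · exact fun a ha w hw => hAW a ha w (Finset.mem_sdiff.1 hw).1
        refine (h1.union ?_ (HasMatching.of_adj hxy)).mono ?_
        · rw [Finset.disjoint_union_left]
          refine ⟨hAR.mono_right ?_, Finset.sdiff_disjoint⟩
          intro v hv
          simp only [Finset.mem_insert, Finset.mem_singleton] at hv
          rcases hv with rfl | rfl <;> assumption
        · intro v hv
          simp only [Finset.mem_union, Finset.mem_sdiff, Finset.mem_insert,
            Finset.mem_singleton] at hv ⊢
          rcases hv with (hv | hv) | rfl | rfl
          · exact Or.inl hv
          · exact Or.inr (hWR hv.1)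
          · exact Or.inr hx
          · exact Or.inr hy
      · have hsub : ∀ v ∈ R, v ∉ ({x, y} : Finset V) → (R.filter (G.Adj v)).card = 0 := by
          intro v hv hvxy
          rw [Finset.card_eq_zero, Finset.filter_eq_empty_iff]
          intro z hz hvz
          simp only [Finset.mem_insert, Finset.mem_singleton, not_or] at hvxy
          have hnA : ∀ u ∈ R, u ∉ A := fun u hu => ((hmR u).1 hu).2.1
          rcases edges_meet_of_hub hG hW hAW hA (hnA x hx) (hnA y hy) (hnA v hv) (hnA z hz)
            (hfull x hx) (hfull v hv) hxy hvz with h | h | h | h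
          · exact hvxy.1 h.symm
          · subst h
            exact hvxy.2 (huniq x hx v hv y hy hvz.symm hxy)
          · exact hvxy.2 h.symm
          · subst h
            exact hvxy.1 (huniq y hy v hv x hx hvz.symm hxy.symm)
        have hxyR : ({x, y} : Finset V) ⊆ R := by
          intro v hv
          simp only [Finset.mem_insert, Finset.mem_singleton] at hv
          rcases hv with rfl | rfl <;> assumption
        unfold adjCount
        rw [← Finset.sum_subset hxyR hsub]
        refine (Finset.sum_le_card_nsmul _ _ 1 fun v hv => hdegR v (hxyR hv)).trans ?_
        have : ({x, y} : Finset V).card ≤ 2 := Finset.card_le_two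
        simpa using this
    · push Not at he
      refine ⟨0, by omega, ?_, (adjCount_eq_zero G he).le⟩
      exact (HasMatching.of_complete_bipartite A W (hAR.mono_right hWR) (by omega) hAW).mono
        (Finset.union_subset_union_right hWR)
  obtain ⟨e, he, hme, hce⟩ := hRR
  obtain ⟨q, hmq, hcq⟩ := exists_matching_adjCount_le hG U
  refine ⟨e, q, he, ?_, ?_⟩
  · have := hme.union hARU hmq
    rwa [← hX] at this
  · have hXc : X.card = A.card + R.card + U.card := by
      conv_lhs => rw [hX]
      rw [Finset.card_union_of_disjoint hARU, Finset.card_union_of_disjoint hAR]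
    have h1 : adjCount G X X = adjCount G (A ∪ R) (A ∪ R) + 2 * adjCount G (A ∪ R) U +
        adjCount G U U := by
      conv_lhs => rw [hX]
      rw [adjCount_union_self G hARU]
    rw [h1, hcross, adjCount_union_self G hAR, hXc]
    have h2 := adjCount_self_le G A
    have h3 := adjCount_le_mul G A R
    linarith

/-- A graph without a path on `2 * |A| + 3` vertices, in which the vertices of `A` have many
common neighbours, has few edges in excess of `|A| * (|X| - |A|)` unless it has a large
matching. -/
theorem adjCount_le_of_hub (hG : PathsShorterThan G (2 * A.card + 3))
    (hW : A.card + 5 ≤ W.card) (hAW : ∀ a ∈ A, ∀ w ∈ W, G.Adj a w) (hA : A.Nonempty)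
    (X : Finset V) (hAX : A ⊆ X) (hWX : W ⊆ X) :
    ∃ e q, e ≤ 1 ∧ HasMatching G X (A.card + e + (A.card + 1) * q) ∧
      adjCount G X X + 2 * A.card * A.card ≤
        A.card * (A.card - 1) + 2 * A.card * X.card + 2 * e + 2 * ((A.card + 1) * q) := by
  classical
  induction X using Finset.strongInduction with
  | H X ih =>
  -- Only vertices outside `A ∪ W` are deleted, so the hub and its common neighbours survive the
  -- induction.
  by_cases hlow : ∃ v ∈ X, v ∉ A ∧ v ∉ W ∧ (X.filter (G.Adj v)).card ≤ A.card
  · obtain ⟨v, hv, hvA, hvW, hdeg⟩ := hlow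
    obtain ⟨e, q, he, hm, hq⟩ := ih (X.erase v) (Finset.erase_ssubset hv)
      (Finset.subset_erase.2 ⟨hAX, hvA⟩) (Finset.subset_erase.2 ⟨hWX, hvW⟩)
    refine ⟨e, q, he, hm.mono (Finset.erase_subset _ _), ?_⟩
    rw [adjCount_erase G hv]
    rw [← Finset.card_erase_add_one hv]
    linarith
  · push Not at hlow
    refine adjCount_le_of_hub_of_lt_degree hG hW hAW hA hAX hWX fun v hv h1 h2 => ?_
    convert hlow v hv h1 h2

end Hub

/-! ### The upper bound for large n -/

/-- A graph without a matching of size `r` has either a `k`-set with `L` common neighbours, or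
at most `(k - 1) * n + O(1)` edges. -/
theorem exists_hub_or_adjCount_le {V : Type*} [Fintype V] [DecidableEq V] {G : SimpleGraph V}
    {r : ℕ} (k L : ℕ) (hG : ¬ HasMatching G Finset.univ r) :
    (∃ A W : Finset V, A.card = k ∧ L ≤ W.card ∧ ∀ a ∈ A, ∀ w ∈ W, G.Adj a w) ∨
      adjCount G Finset.univ Finset.univ ≤ 2 * (k - 1) * Fintype.card V +
        (2 * r * (2 * r) + 2 * (2 * r * (2 ^ (2 * r) * L))) := by
  classical
  obtain ⟨S, -, hS, hind⟩ := exists_cover_of_not_hasMatching r _ hG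
  set T : Finset V := Finset.univ \ S with hT
  set B := T.filter fun v => k ≤ (S.filter (G.Adj v)).card with hB
  have hsub : ∀ v ∈ B, ∃ A ⊆ S.filter (G.Adj v), A.card = k := fun v hv =>
    Finset.exists_subset_card_eq (Finset.mem_filter.1 hv).2
  choose! N hN hNc using hsub
  -- If `B` is large, more than `L` of its vertices chose the same `k`-subset of the cover.
  by_cases hlt : (S.powersetCard k).card * L < B.card
  · left
    obtain ⟨A, hA, hcard⟩ := Finset.exists_lt_card_fiber_of_mul_lt_card_of_maps_to
      (s := B) (t := S.powersetCard k) (f := N) (fun v hv => Finset.mem_powersetCard.2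
        ⟨(hN v hv).trans (Finset.filter_subset _ _), hNc v hv⟩) hlt
    refine ⟨A, _, (Finset.mem_powersetCard.1 hA).2, hcard.le, ?_⟩
    intro a ha w hw
    obtain ⟨hwB, rfl⟩ := Finset.mem_filter.1 hw
    exact (Finset.mem_filter.1 (hN w hwB ha)).2.symm
  · right
    have hBc : B.card ≤ 2 ^ (2 * r) * L := by
      have h1 : (S.powersetCard k).card ≤ 2 ^ (2 * r) := by
        refine (Finset.card_le_card (fun A hA => Finset.mem_powerset.2
          (Finset.mem_powersetCard.1 hA).1)).trans ?_
        rw [Finset.card_powerset]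
        exact Nat.pow_le_pow_right (by norm_num) hS
      exact (not_lt.1 hlt).trans (Nat.mul_le_mul_right _ h1)
    have hdisj : Disjoint S T := Finset.disjoint_sdiff
    have huniv : (Finset.univ : Finset V) = S ∪ T :=
      (Finset.union_sdiff_of_subset (Finset.subset_univ S)).symm
    have hTT : adjCount G T T = 0 := adjCount_eq_zero G hind
    have hSS : adjCount G S S ≤ 2 * r * (2 * r) :=
      (adjCount_le_mul G S S).trans (Nat.mul_le_mul hS hS)
    have hTS : adjCount G T S ≤ (k - 1) * Fintype.card V + 2 * r * (2 ^ (2 * r) * L) := by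
      have h1 : adjCount G T S ≤ ∑ v ∈ T, ((k - 1) + if v ∈ B then 2 * r else 0) := by
        refine Finset.sum_le_sum fun v hv => ?_
        split_ifs with hvB
        · have := Finset.card_filter_le S (G.Adj v)
          omega
        · rw [hB, Finset.mem_filter] at hvB
          have : ¬ k ≤ (S.filter (G.Adj v)).card := fun h => hvB ⟨hv, h⟩
          omega
      refine h1.trans ?_
      rw [Finset.sum_add_distrib, Finset.sum_const, ← Finset.sum_filter, Finset.sum_const,
        smul_eq_mul, smul_eq_mul, Finset.filter_mem_eq_inter]
      have h2 : T.card ≤ Fintype.card V := Finset.card_le_univ T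
      have h3 : (T ∩ B).card ≤ 2 ^ (2 * r) * L :=
        (Finset.card_le_card Finset.inter_subset_right).trans hBc
      rw [Nat.mul_comm (k - 1), Nat.mul_comm (2 * r)]
      exact Nat.add_le_add (Nat.mul_le_mul_right _ h2) (Nat.mul_le_mul_right _ h3)
    rw [huniv, adjCount_union_self G hdisj, adjCount_comm G S T, hTT]
    linarith

/-- The integers `e` and `q` record how the excess is paid for; optimising them is left to the two
divisibility cases. The term `2 * k * k` stands on the left to avoid truncated subtraction. -/
theorem exists_edge_bound_of_familyFree {k s : ℕ} (hk : 1 ≤ k) (hs : k ≤ s) :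
    ∃ N : ℕ, ∀ n : ℕ, N ≤ n → ∀ G : SimpleGraph (Fin n),
      FamilyFree (pathMatchingFamily (2 * (k + 1) + 1) (s + 1)) G →
      ∃ e q, e ≤ 1 ∧ k + e + (k + 1) * q ≤ s ∧
        2 * G.edgeSet.ncard + 2 * k * k ≤
          k * (k - 1) + 2 * k * n + 2 * e + 2 * ((k + 1) * q) := by
  set C := 2 * (s + 1) * (2 * (s + 1)) +
    2 * (2 * (s + 1) * (2 ^ (2 * (s + 1)) * (k + 5))) with hC
  refine ⟨C + 2 * k * k, fun n hn G hG => ?_⟩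
  have hpath : PathsShorterThan G (2 * k + 3) :=
    pathsShorterThan_of_free (hG ⟨_, _⟩ (Or.inl rfl))
  have hmatch : ¬ HasMatching G Finset.univ (s + 1) := fun h =>
    hG ⟨_, matchingGraph (s + 1)⟩ (Or.inr rfl) (isContained_matchingGraph h)
  rcases exists_hub_or_adjCount_le k (k + 5) hmatch with ⟨A, W, rfl, hW, hAW⟩ | hle
  · obtain ⟨e, q, he, hm, hle⟩ := adjCount_le_of_hub hpath hW hAW (Finset.card_pos.1 hk)
      Finset.univ (Finset.subset_univ _) (Finset.subset_univ _)
    refine ⟨e, q, he, ?_, ?_⟩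
    · by_contra! h
      exact hmatch (hm.of_le h)
    · rwa [adjCount_univ, Finset.card_univ, Fintype.card_fin] at hle
  -- Without a hub the slope is `k - 1`, so the gain of `2 * n` absorbs `C + 2 * k * k`.
  · refine ⟨0, 0, by omega, by omega, ?_⟩
    rw [adjCount_univ, Fintype.card_fin, ← hC] at hle
    obtain ⟨j, rfl⟩ : ∃ j, k = j + 1 := ⟨k - 1, by omega⟩
    rw [Nat.add_sub_cancel] at hle
    nlinarith

/-! ### Edge counts of the extremal graphs -/

theorem adjCount_eq_mul {V : Type*} {G : SimpleGraph V} {X Y : Finset V}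
    (h : ∀ x ∈ X, ∀ y ∈ Y, G.Adj x y) : adjCount G X Y = X.card * Y.card := by
  classical
  refine (Finset.sum_congr rfl fun x hx => ?_).trans (Finset.sum_const Y.card)
  rw [Finset.filter_true_of_mem (h x hx)]

theorem adjCount_self_eq {V : Type*} {G : SimpleGraph V} {X : Finset V}
    (h : ∀ x ∈ X, ∀ y ∈ X, x ≠ y → G.Adj x y) : adjCount G X X = X.card * (X.card - 1) := by
  classical
  refine (Finset.sum_congr rfl fun x hx => ?_).trans (Finset.sum_const (X.card - 1))
  rw [← Finset.card_erase_of_mem hx]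
  congr 1
  ext y
  simp only [Finset.mem_filter, Finset.mem_erase]
  exact ⟨fun hy => ⟨hy.2.ne', hy.1⟩, fun hy => ⟨hy.2, h x hx y hy.2 hy.1.symm⟩⟩

theorem two_mul_ncard_edgeSet_hubGraph {m k : ℕ} (hk : k ≤ m) :
    2 * (hubGraph m k).edgeSet.ncard = k * (k - 1) + 2 * (k * (m - k)) := by
  classical
  have h1 : (Finset.univ.filter fun v : Fin m => v.val < k).card = k := by
    rw [Fin.card_filter_val_lt, min_eq_right hk]
  have h2 : (Finset.univ.filter fun v : Fin m => ¬ v.val < k).card = m - k := by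
    have := Finset.card_filter_add_card_filter_not (s := (Finset.univ : Finset (Fin m)))
      (fun v : Fin m => v.val < k)
    rw [h1, Finset.card_univ, Fintype.card_fin] at this
    omega
  rw [← adjCount_univ, ← Finset.filter_union_filter_not_eq (fun v : Fin m => v.val < k)
    Finset.univ, adjCount_union_self _ (Finset.disjoint_filter_filter_not _ _ _),
    adjCount_self_eq, adjCount_eq_mul, adjCount_eq_zero, h1, h2]
  · ring
  · intro x hx y hy h
    simp only [Finset.mem_filter, Finset.mem_univ, true_and] at hx hy
    exact h.2.elim hx hy
  · intro x hx y hy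
    simp only [Finset.mem_filter, Finset.mem_univ, true_and] at hx hy
    exact ⟨fun e => hy (e ▸ hx), Or.inl hx⟩
  · intro x hx y _ hne
    exact ⟨hne, Or.inl (Finset.mem_filter.1 hx).2⟩

theorem ncard_edgeSet_hubGraphPlusEdge {m k : ℕ} (hk : k + 2 ≤ m) :
    (hubGraphPlusEdge m k).edgeSet.ncard = (hubGraph m k).edgeSet.ncard + 1 := by
  have h : (hubGraphPlusEdge m k).edgeSet =
      insert s(⟨k, by omega⟩, ⟨k + 1, by omega⟩) (hubGraph m k).edgeSet := by
    ext e
    induction e with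
    | _ u v =>
      simp only [hubGraphPlusEdge, SimpleGraph.mem_edgeSet, SimpleGraph.sup_adj,
        SimpleGraph.fromRel_adj, Set.mem_insert_iff, Sym2.eq_iff, Fin.ext_iff]
      constructor
      · rintro (h | ⟨-, h | h⟩)
        · exact Or.inr h
        · exact Or.inl (Or.inl h)
        · exact Or.inl (Or.inr ⟨h.2, h.1⟩)
      · rintro ((h | h) | h)
        · exact Or.inr ⟨fun e => by rw [e] at h; omega, Or.inl h⟩
        · exact Or.inr ⟨fun e => by rw [e] at h; omega, Or.inr ⟨h.2, h.1⟩⟩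
        · exact Or.inl h
  rw [h, Set.ncard_insert_of_notMem _ (Set.toFinite _)]
  rw [SimpleGraph.mem_edgeSet]
  intro h
  rcases h.2 with h | h <;> simp at h

theorem two_mul_ncard_edgeSet_cliqueCopies (t m : ℕ) :
    2 * (cliqueCopies t m).edgeSet.ncard = t * (m * (m - 1)) := by
  classical
  rw [← adjCount_univ]
  refine (Finset.sum_congr rfl fun x _ => ?_).trans
    ((Finset.sum_const (m - 1)).trans ?_)
  · have h : (Finset.univ.filter ((cliqueCopies t m).Adj x)) =
        (({x.1} : Finset (Fin t)) ×ˢ (Finset.univ : Finset (Fin m))).erase x := by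
      ext y
      rw [Finset.mem_filter, Finset.mem_erase, Finset.mem_product, Finset.mem_singleton]
      simp only [cliqueCopies, Finset.mem_univ, true_and, and_true]
      exact ⟨fun h => ⟨h.1.symm, h.2.symm⟩, fun h => ⟨h.1.symm, h.2.symm⟩⟩
    rw [h, Finset.card_erase_of_mem (by simp)]
    simp
  · simp [mul_assoc]

theorem ncard_edgeSet_sum {V W : Type*} [Fintype V] [Fintype W] (G : SimpleGraph V)
    (H : SimpleGraph W) :
    (SimpleGraph.sum G H).edgeSet.ncard = G.edgeSet.ncard + H.edgeSet.ncard := by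
  classical
  have h : adjCount (SimpleGraph.sum G H) Finset.univ Finset.univ =
      adjCount G Finset.univ Finset.univ + adjCount H Finset.univ Finset.univ := by
    simp only [adjCount_eq_sum, Fintype.sum_sum_type]
    simp
  simp only [adjCount_univ] at h
  omega

/-! ### The extremal graphs avoid the path and the matching -/

/-- Each of the k hub vertices lies on at most two edges of a path, and the extra edge is used at
most once, so a path has at most 2k + 1 edges. -/
theorem not_path_of_hub {k : ℕ} {h : ℕ → ℕ}
    (hinj : ∀ i < 2 * k + 3, ∀ j < 2 * k + 3, h i = h j → i = j)
    (hadj : ∀ i < 2 * k + 2, h i < k ∨ h (i + 1) < k ∨ (h i = k ∧ h (i + 1) = k + 1) ∨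
      (h i = k + 1 ∧ h (i + 1) = k)) : False := by
  -- Encodes an edge by a hub vertex on it and the side on which that vertex lies; `2 * k` stands
  -- for the extra edge.
  let f : ℕ → ℕ := fun i => if h i < k then 2 * h i else
    if h (i + 1) < k then 2 * h (i + 1) + 1 else 2 * k
  obtain ⟨i, hi, j, hj, hne, hij⟩ := Finset.exists_ne_map_eq_of_card_lt_of_maps_to
    (s := Finset.range (2 * k + 2)) (t := Finset.range (2 * k + 1)) (f := f) (by simp)
    (by
      intro i _
      simp only [f, Finset.coe_range, Set.mem_Iio]
      split_ifs <;> omega)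
  rw [Finset.mem_range] at hi hj
  have h1 := hinj i (by omega) j (by omega)
  have h2 := hinj (i + 1) (by omega) (j + 1) (by omega)
  have h3 := hinj i (by omega) (j + 1) (by omega)
  have h4 := hinj (i + 1) (by omega) j (by omega)
  have h5 := hadj i hi
  have h6 := hadj j hj
  simp only [f] at hij
  split_ifs at hij <;> omega

/-- A path stays in one summand: on the left it is excluded by `not_path_of_hub`, on the right it is
confined to one clique, which has a vertex too few. -/
theorem pathGraph_free_sum {m k t : ℕ} {H : SimpleGraph (Fin m)}
    (hH : H ≤ hubGraphPlusEdge m k) :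
    (SimpleGraph.pathGraph (2 * (k + 1) + 1)).Free
      (SimpleGraph.sum H (cliqueCopies t (2 * (k + 1)))) := by
  rintro ⟨f⟩
  have hinj := f.injective
  have hadj : ∀ i (hi : i + 1 < 2 * (k + 1) + 1),
      (SimpleGraph.sum H (cliqueCopies t (2 * (k + 1)))).Adj (f ⟨i, by omega⟩)
        (f ⟨i + 1, hi⟩) := fun i hi => f.toHom.map_adj (by
    rw [SimpleGraph.pathGraph_adj]; exact Or.inl rfl)
  rcases h0 : f ⟨0, by omega⟩ with x | x
  · have hl : ∀ i (hi : i < 2 * (k + 1) + 1), ∃ y, f ⟨i, hi⟩ = Sum.inl y := by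
      intro i
      induction i with
      | zero => exact fun _ => ⟨x, h0⟩
      | succ i ih =>
        intro hi
        obtain ⟨y, hy⟩ := ih (by omega)
        have := hadj i hi
        rw [hy] at this
        rcases hz : f ⟨i + 1, hi⟩ with z | z
        · exact ⟨z, rfl⟩
        · rw [hz] at this
          simp at this
    choose g hg using hl
    let h : ℕ → ℕ := fun i => if hi : i < 2 * (k + 1) + 1 then (g i hi).val else 0
    have hh : ∀ i (hi : i < 2 * (k + 1) + 1), h i = (g i hi).val := fun i hi => dif_pos hi
    refine not_path_of_hub (k := k) (h := h) ?_ ?_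
    · intro i hi j hj hij
      rw [hh i hi, hh j hj] at hij
      have := @hinj ⟨i, hi⟩ ⟨j, hj⟩ ((hg i hi).trans (by rw [Fin.ext hij]; exact (hg j hj).symm))
      simpa using this
    · intro i hi
      have := hadj i (by omega)
      rw [hg, hg] at this
      rw [hh i (by omega), hh (i + 1) (by omega)]
      have := hH (SimpleGraph.sum_adj_inl.1 this)
      rw [hubGraphPlusEdge, SimpleGraph.sup_adj, SimpleGraph.fromRel_adj] at this
      rcases this with h | ⟨-, h | h⟩
      · rcases h.2 with h | h
        · exact Or.inl h
        · exact Or.inr (Or.inl h)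
      · exact Or.inr (Or.inr (Or.inl h))
      · exact Or.inr (Or.inr (Or.inr ⟨h.2, h.1⟩))
  · have hr : ∀ i (hi : i < 2 * (k + 1) + 1), ∃ y, f ⟨i, hi⟩ = Sum.inr (x.1, y) := by
      intro i
      induction i with
      | zero => exact fun _ => ⟨x.2, h0⟩
      | succ i ih =>
        intro hi
        obtain ⟨y, hy⟩ := ih (by omega)
        have := hadj i hi
        rw [hy] at this
        rcases hz : f ⟨i + 1, hi⟩ with z | z
        · rw [hz] at this
          simp at this
        · rw [hz] at this
          have : x.1 = z.1 := (SimpleGraph.sum_adj_inr.1 this).2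
          exact ⟨z.2, by rw [this]⟩
    choose g hg using hr
    have : Function.Injective fun i : Fin (2 * (k + 1) + 1) => g i.val i.2 := by
      intro i j hij
      refine hinj ?_
      have h1 := hg i.val i.2
      have h2 := hg j.val j.2
      dsimp only at hij
      rw [hij] at h1
      exact h1.trans h2.symm
    have := Fintype.card_le_of_injective _ this
    simp at this

/-- Matching edges in `H` use distinct vertices of the cover of size `c`; those in the cliques use
two each of the `t * (2 * k)` vertices there. -/
theorem matchingGraph_free_sum {m c t k r : ℕ} {H : SimpleGraph (Fin m)}
    (hH : ∀ u v, H.Adj u v → u.val < c ∨ v.val < c) (hr : c + t * k < r) :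
    (matchingGraph r).Free (SimpleGraph.sum H (cliqueCopies t (2 * k))) := by
  classical
  rintro ⟨f⟩
  have hinj := f.injective
  let a : Fin r → Fin (2 * r) := fun i => ⟨2 * i.val, by omega⟩
  let b : Fin r → Fin (2 * r) := fun i => ⟨2 * i.val + 1, by omega⟩
  have hadj : ∀ i, (SimpleGraph.sum H (cliqueCopies t (2 * k))).Adj (f (a i)) (f (b i)) := by
    intro i
    refine f.toHom.map_adj ⟨?_, ?_⟩
    · simp [a, b]
    · simp only [a, b]; omega
  let I := Finset.univ.filter fun i => (f (a i)).isLeft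
  let J := Finset.univ.filter fun i => ¬ (f (a i)).isLeft
  have hIJ : I.card + J.card = r := by
    have := Finset.card_filter_add_card_filter_not (s := (Finset.univ : Finset (Fin r)))
      (fun i => (f (a i)).isLeft = true)
    simpa [I, J] using this
  have hI : I.card ≤ c := by
    have h1 : ∀ i ∈ I, ∃ x < c, ∃ j : Fin (2 * r), ∃ u : Fin m, j.val / 2 = i.val ∧
        f j = Sum.inl u ∧ u.val = x := by
      intro i hi
      have h := hadj i
      have h' := (Finset.mem_filter.1 hi).2
      rcases hu : f (a i) with u | u
      · rcases hv : f (b i) with v | v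
        · rw [hu, hv] at h
          rcases hH u v (SimpleGraph.sum_adj_inl.1 h) with h | h
          · exact ⟨u, h, a i, u, by simp [a], hu, rfl⟩
          · exact ⟨v, h, b i, v, by simp only [b]; omega, hv, rfl⟩
        · rw [hu, hv] at h
          simp at h
      · rw [hu] at h'
        simp at h'
    choose! g hg hj using h1
    rw [← Finset.card_range c]
    refine Finset.card_le_card_of_injOn g
      (fun i hi => Finset.mem_coe.2 (Finset.mem_range.2 (hg i hi))) ?_
    intro x hx y hy hxy
    obtain ⟨j, u, hj1, hj2, hj3⟩ := hj x hx
    obtain ⟨j', u', hj1', hj2', hj3'⟩ := hj y hy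
    have hu : u = u' := Fin.ext (by rw [hj3, hj3', hxy])
    have := @hinj j j' (hj2.trans (by rw [hu]; exact hj2'.symm))
    exact Fin.ext (by rw [← hj1, ← hj1', this])
  have hJ : 2 * J.card ≤ t * (2 * k) := by
    have h1 : ∀ i ∈ J, ∀ e : Bool, ∃ y, f (if e then a i else b i) = Sum.inr y := by
      intro i hi e
      have h := hadj i
      have h' := (Finset.mem_filter.1 hi).2
      rcases hu : f (a i) with u | u
      · rw [hu] at h'
        simp at h'
      · rcases hv : f (b i) with v | v
        · rw [hu, hv] at h
          simp at h
        · cases e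
          · exact ⟨v, hv⟩
          · exact ⟨u, hu⟩
    have h2 : (J ×ˢ (Finset.univ : Finset Bool)).card ≤
        ((Finset.univ : Finset (Fin t × Fin (2 * k))).image
          (Sum.inr : _ → Fin m ⊕ (Fin t × Fin (2 * k)))).card := by
      refine Finset.card_le_card_of_injOn
        (fun p : Fin r × Bool => f (if p.2 then a p.1 else b p.1)) ?_ ?_
      · intro p hp
        rw [Finset.mem_coe, Finset.mem_product] at hp
        obtain ⟨y, hy⟩ := h1 p.1 hp.1 p.2
        rw [Finset.mem_coe, Finset.mem_image]
        exact ⟨y, Finset.mem_univ _, hy.symm⟩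
      · rintro ⟨x, e⟩ - ⟨y, e'⟩ - hxy
        have := hinj hxy
        cases e <;> cases e' <;> simp [a, b] at this ⊢ <;> omega
    have h3 := h2.trans Finset.card_image_le
    simp at h3
    linarith
  have : t * (2 * k) = 2 * (t * k) := by ring
  omega

/-! ### Extremal values and conclusion -/

theorem two_mul_choose_two (n : ℕ) : 2 * n.choose 2 = n * (n - 1) := by
  rw [Nat.choose_two_right, Nat.mul_div_cancel' (Nat.even_mul_pred_self n).two_dvd]

theorem exFamily_eq_of_forall_le {V : Type*} [Fintype V] {n : ℕ}
    {𝓕 : Set (Σ m : ℕ, SimpleGraph (Fin m))} {H : SimpleGraph V} (hV : Fintype.card V = n)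
    (hfree : FamilyFree 𝓕 H)
    (hle : ∀ G : SimpleGraph (Fin n), FamilyFree 𝓕 G → G.edgeSet.ncard ≤ H.edgeSet.ncard) :
    exFamily n 𝓕 = H.edgeSet.ncard ∧
      ∃ G : SimpleGraph (Fin n), IsExtremalFor 𝓕 G ∧ Nonempty (G ≃g H) := by
  classical
  let f := SimpleGraph.overFinIso H hV
  have hG : FamilyFree 𝓕 (H.overFin hV) := fun F hF =>
    (SimpleGraph.free_congr_right f).1 (hfree F hF)
  have hcard : (H.overFin hV).edgeSet.ncard = H.edgeSet.ncard :=
    (Nat.card_congr f.mapEdgeSet).symm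
  have hex : exFamily n 𝓕 = H.edgeSet.ncard := by
    apply le_antisymm
    · refine Finset.sup_le fun G hG => ?_
      rw [← Set.ncard_coe_finset, SimpleGraph.coe_edgeFinset]
      exact hle G (Finset.mem_filter.1 hG).2
    · rw [← hcard, ← SimpleGraph.coe_edgeFinset, Set.ncard_coe_finset]
      exact Finset.le_sup (f := fun G : SimpleGraph (Fin n) => G.edgeFinset.card)
        (Finset.mem_filter.2 ⟨Finset.mem_univ _, hG⟩)
  exact ⟨hex, H.overFin hV, ⟨hG, hcard.trans hex.symm⟩, ⟨f.symm⟩⟩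

theorem familyFree_sum {m c k t s : ℕ} {H : SimpleGraph (Fin m)}
    (hH : H ≤ hubGraphPlusEdge m k) (hc : ∀ u v, H.Adj u v → u.val < c ∨ v.val < c)
    (hs : c + t * (k + 1) ≤ s) :
    FamilyFree (pathMatchingFamily (2 * (k + 1) + 1) (s + 1))
      (SimpleGraph.sum H (cliqueCopies t (2 * (k + 1)))) := by
  rintro F (rfl | rfl)
  · exact pathGraph_free_sum hH
  · exact matchingGraph_free_sum hc (by omega)

theorem exFamily_eq_of_dvd {k t : ℕ} (hk : 1 ≤ k) :
    ∃ N : ℕ, ∀ n : ℕ, N ≤ n → 2 * ((k + 1) * t) ≤ n ∧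
      2 * exFamily n (pathMatchingFamily (2 * (k + 1) + 1) (k + (k + 1) * t + 1)) + 2 * k * k =
        k * (k - 1) + 2 * k * n + 2 * ((k + 1) * t) ∧
      ∃ G : SimpleGraph (Fin n),
        IsExtremalFor (pathMatchingFamily (2 * (k + 1) + 1) (k + (k + 1) * t + 1)) G ∧
        Nonempty (G ≃g SimpleGraph.sum (hubGraph (n - 2 * ((k + 1) * t)) k)
          (cliqueCopies t (2 * (k + 1)))) := by
  obtain ⟨N, hN⟩ := exists_edge_bound_of_familyFree hk (Nat.le_add_right k ((k + 1) * t))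
  refine ⟨N + 2 * ((k + 1) * t) + k, fun n hn => ⟨by omega, ?_⟩⟩
  obtain ⟨m, rfl⟩ : ∃ m, n = m + k + 2 * ((k + 1) * t) :=
    ⟨n - k - 2 * ((k + 1) * t), by omega⟩
  rw [Nat.add_sub_cancel]
  have hedge : 2 * (SimpleGraph.sum (hubGraph (m + k) k)
      (cliqueCopies t (2 * (k + 1)))).edgeSet.ncard + 2 * k * k =
        k * (k - 1) + 2 * k * (m + k + 2 * ((k + 1) * t)) + 2 * ((k + 1) * t) := by
    rw [ncard_edgeSet_sum, mul_add, two_mul_ncard_edgeSet_hubGraph (Nat.le_add_left k m),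
      two_mul_ncard_edgeSet_cliqueCopies, Nat.add_sub_cancel,
      show 2 * (k + 1) - 1 = 2 * k + 1 by omega]
    ring
  obtain ⟨h1, h2⟩ := exFamily_eq_of_forall_le (n := m + k + 2 * ((k + 1) * t))
    (H := SimpleGraph.sum (hubGraph (m + k) k) (cliqueCopies t (2 * (k + 1))))
    (by simp only [Fintype.card_sum, Fintype.card_prod, Fintype.card_fin]; ring)
    (familyFree_sum (c := k) le_sup_left (fun u v h => h.2) (Nat.add_le_add_left (by rw [mul_comm]) k))
    (by
      intro G hG
      obtain ⟨e, q, he, hq, hle⟩ := hN _ (by omega) G hG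
      omega)
  rw [h1]
  exact ⟨hedge, h2⟩

/-- Here `r` is the remainder of s - k modulo k + 1: `0 < r` leaves room in the matching number for
the extra edge, and `r ≤ k` rules out another clique. -/
theorem exFamily_eq_of_not_dvd {k t r : ℕ} (hk : 1 ≤ k) (hr : 0 < r) (hrk : r ≤ k) :
    ∃ N : ℕ, ∀ n : ℕ, N ≤ n →
      2 * exFamily n (pathMatchingFamily (2 * (k + 1) + 1) (k + (k + 1) * t + r + 1)) +
          2 * k * k = k * (k - 1) + 2 * k * n + 2 + 2 * ((k + 1) * t) ∧
      ∃ G : SimpleGraph (Fin n),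
        IsExtremalFor (pathMatchingFamily (2 * (k + 1) + 1) (k + (k + 1) * t + r + 1)) G ∧
        Nonempty (G ≃g SimpleGraph.sum (hubGraphPlusEdge (n - 2 * (k + 1) * t) k)
          (cliqueCopies t (2 * (k + 1)))) := by
  obtain ⟨N, hN⟩ := exists_edge_bound_of_familyFree hk
    (show k ≤ k + (k + 1) * t + r by omega)
  refine ⟨N + 2 * (k + 1) * t + k + 2, fun n hn => ?_⟩
  obtain ⟨m, rfl⟩ : ∃ m, n = m + 2 + k + 2 * (k + 1) * t :=
    ⟨n - k - 2 * (k + 1) * t - 2, by omega⟩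
  rw [Nat.add_sub_cancel]
  have hedge : 2 * (SimpleGraph.sum (hubGraphPlusEdge (m + 2 + k) k)
      (cliqueCopies t (2 * (k + 1)))).edgeSet.ncard + 2 * k * k =
        k * (k - 1) + 2 * k * (m + 2 + k + 2 * (k + 1) * t) + 2 + 2 * ((k + 1) * t) := by
    rw [ncard_edgeSet_sum, ncard_edgeSet_hubGraphPlusEdge (by omega), mul_add, mul_add,
      two_mul_ncard_edgeSet_hubGraph (Nat.le_add_left k (m + 2)),
      two_mul_ncard_edgeSet_cliqueCopies, Nat.add_sub_cancel,
      show 2 * (k + 1) - 1 = 2 * k + 1 by omega]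
    ring
  obtain ⟨h1, h2⟩ := exFamily_eq_of_forall_le (n := m + 2 + k + 2 * (k + 1) * t)
    (H := SimpleGraph.sum (hubGraphPlusEdge (m + 2 + k) k) (cliqueCopies t (2 * (k + 1))))
    (𝓕 := pathMatchingFamily (2 * (k + 1) + 1) (k + (k + 1) * t + r + 1))
    (by simp only [Fintype.card_sum, Fintype.card_prod, Fintype.card_fin]; ring)
    (by
      -- The hub together with one end of the extra edge covers all edges.
      refine familyFree_sum (c := k + 1) le_rfl ?_ ?_
      · intro u v h
        rw [hubGraphPlusEdge, SimpleGraph.sup_adj, SimpleGraph.fromRel_adj] at h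
        rcases h with h | ⟨-, h | h⟩
        · rcases h.2 with h | h <;> omega
        · omega
        · omega
      · rw [mul_comm t]; omega)
    (by
      intro G hG
      obtain ⟨e, q, he, hq, hle⟩ := hN _ (by omega) G hG
      have hqt : q ≤ t := by
        by_contra! h
        have : (k + 1) * (t + 1) ≤ (k + 1) * q := Nat.mul_le_mul_left _ h
        rw [mul_add] at this
        omega
      have : (k + 1) * q ≤ (k + 1) * t := Nat.mul_le_mul_left _ hqt
      omega)
  rw [h1]
  exact ⟨hedge, h2⟩

theorem proposition4 (ℓ s : ℕ) (hℓ : 2 ≤ ℓ) (hs : ℓ ≤ s) :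
    (ℓ ∣ s - ℓ + 1 → ∃ N : ℕ, ∀ n : ℕ, N ≤ n →
      (exFamily n (pathMatchingFamily (2 * ℓ + 1) (s + 1)) : ℤ) =
          ((ℓ : ℤ) - 1) * ((n : ℤ) - 2 * s + ℓ - 1) + ((ℓ - 1).choose 2 : ℕ)
            + ((s : ℤ) - ℓ + 1) * (2 * ℓ - 1) ∧
      ∃ G : SimpleGraph (Fin n),
        IsExtremalFor (pathMatchingFamily (2 * ℓ + 1) (s + 1)) G ∧
        Nonempty (G ≃g SimpleGraph.sum (hubGraph (n - (2 * s - 2 * ℓ + 2)) (ℓ - 1))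
          (cliqueCopies ((s - ℓ + 1) / ℓ) (2 * ℓ)))) ∧
    (¬ ℓ ∣ s - ℓ + 1 → ∀ t : ℕ, t = (s - ℓ + 1) / ℓ → ∃ N : ℕ, ∀ n : ℕ, N ≤ n →
      (exFamily n (pathMatchingFamily (2 * ℓ + 1) (s + 1)) : ℤ) =
          ((ℓ : ℤ) - 1) * ((n : ℤ) - ℓ + 1 - 2 * ℓ * t) + 1 + ((ℓ - 1).choose 2 : ℕ)
            + t * ((2 * ℓ).choose 2 : ℕ) ∧
      ∃ G : SimpleGraph (Fin n),
        IsExtremalFor (pathMatchingFamily (2 * ℓ + 1) (s + 1)) G ∧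
        Nonempty (G ≃g SimpleGraph.sum (hubGraphPlusEdge (n - 2 * ℓ * t) (ℓ - 1))
          (cliqueCopies t (2 * ℓ)))) := by
  obtain ⟨k, rfl⟩ : ∃ k, ℓ = k + 1 := ⟨ℓ - 1, by omega⟩
  have hk : 1 ≤ k := by omega
  have hchoose := two_mul_choose_two k
  have hkk : k * (k - 1) + k = k * k := by
    obtain ⟨j, rfl⟩ : ∃ j, k = j + 1 := ⟨k - 1, by omega⟩
    rw [Nat.add_sub_cancel]
    ring
  have hsub : s - (k + 1) + 1 = s - k := by omega
  rw [Nat.add_sub_cancel, hsub]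
  refine ⟨?_, ?_⟩
  · rintro ⟨t, ht⟩
    obtain rfl : s = k + (k + 1) * t := by omega
    obtain ⟨N, hN⟩ := exFamily_eq_of_dvd (t := t) hk
    refine ⟨N, fun n hn => ?_⟩
    obtain ⟨hle, hex, hG⟩ := hN n hn
    have e1 : 2 * (k + (k + 1) * t) - 2 * (k + 1) + 2 = 2 * ((k + 1) * t) := by omega
    have e2 : (k + (k + 1) * t - k) / (k + 1) = t := by
      rw [Nat.add_sub_cancel_left, Nat.mul_div_cancel_left _ (Nat.succ_pos k)]
    rw [e1, e2]
    refine ⟨?_, hG⟩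
    zify at hex hchoose hkk
    push_cast at hex hchoose hkk ⊢
    linarith
  · rintro hdvd t rfl
    have hr : 0 < (s - k) % (k + 1) := Nat.pos_of_ne_zero fun h => hdvd (Nat.dvd_of_mod_eq_zero h)
    have hrk : (s - k) % (k + 1) ≤ k := Nat.le_of_lt_succ (Nat.mod_lt _ (Nat.succ_pos k))
    obtain ⟨N, hN⟩ := exFamily_eq_of_not_dvd (t := (s - k) / (k + 1)) hk hr hrk
    have hs' : k + (k + 1) * ((s - k) / (k + 1)) + (s - k) % (k + 1) = s := by
      rw [add_assoc, Nat.div_add_mod]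
      omega
    rw [hs'] at hN
    refine ⟨N, fun n hn => ?_⟩
    obtain ⟨hex, hG⟩ := hN n hn
    refine ⟨?_, hG⟩
    have hc2 := two_mul_choose_two (2 * (k + 1))
    rw [show 2 * (k + 1) - 1 = 2 * k + 1 by omega] at hc2
    generalize (s - k) / (k + 1) = t at hex ⊢
    have hc3 : (t : ℤ) * ((2 * (k + 1)).choose 2 : ℕ) = t * ((k + 1) * (2 * k + 1)) := by
      congr 1
      zify at hc2
      linarith
    rw [hc3]
    zify at hex hchoose hkk
    push_cast at hex hchoose hkk ⊢
    linarith
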